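/- Let $A$ be a unital $C^*$-algebra, represented faithfully and non-degenerately on a Hilbert space $H$, so that $A\subseteq B(H)$ with $1_A = 1_{B(H)}$. Let $n\ge 1$ be an integer. Identify $A^n$ with $M_{n,1}(A)$, with the norm inherited from $M_n(A)$, i.e. $\|a\|^2=\|\sum_{i\le n} a_i^*a_i\|$; then $A^n\subseteq B(H,H^n)$. Let $\mathrm{Lg}_n(A)$ be the set of $n$-tuples $a=(a_1,\dots,a_n)\in A^n$ with $A=Aa_1+\cdots+Aa_n$. Let $a\in A^n$ have polar decomposition $a=v|a|$ in $B(H,H^n)$, where $|a|=(a^*a)^{1/2}$ and $v\in B(H,H^n)$ is the partial isometry with $\ker v=\ker a$. For $\lambda\ge 0$ let $f_\lambda=1_{[0,\lambda]}(|a^*|)\in B(H^n)$ be the spectral projection of $|a^*|=(aa^*)^{1/2}$ for the interval $[0,\lambda]$. Then $$\operatorname{dist}(a,\mathrm{Lg}_n(A))=\inf\{\lambda\ge 0 : \text{there exists } s\in \mathrm{Lg}_n(A) \text{ with } (1-f_\lambda)v=(1-f_\lambda)s\},$$ where the set on the right is non-empty and $\operatorname{dist}$ is the distance in the norm of $A^n$.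 -/

import Mathlib

open scoped InnerProductSpace CompactlySupported

noncomputable section

namespace StableRank

section Spectral

open Filter Topology MeasureTheory

variable {K : Type*} [NormedAddCommGroup K] [InnerProductSpace ℂ K] [CompleteSpace K]

/-- For `S` self-adjoint and a vector `x`, the positive linear functional `f ↦ ⟪x, f(S) x⟫` on
`C_c(ℝ, ℝ)`, where `f(S)` is given by the continuous functional calculus. -/
def spectralFunctional (S : K →L[ℂ] K) (x : K) : C_c(ℝ, ℝ) →ₚ[ℝ] ℝ :=
  PositiveLinearMap.mk₀
    { toFun := fun f => (⟪x, (cfc (f : ℝ → ℝ) S) x⟫_ℂ).re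
      map_add' := fun f g => by
        have h : cfc (⇑(f + g)) S = cfc (⇑f) S + cfc (⇑g) S :=
          cfc_add S f g f.continuous.continuousOn g.continuous.continuousOn
        rw [h, add_apply, inner_add_right, Complex.add_re]
      map_smul' := fun c f => by
        have h : cfc (⇑(c • f)) S = c • cfc (⇑f) S :=
          cfc_smul c (⇑f) S f.continuous.continuousOn
        have h2 : (c • cfc (⇑f) S) x = (c : ℂ) • (cfc (⇑f) S) x := rfl
        rw [h, h2, inner_smul_right]
        simp }
    (fun f hf => by
      have h : (0 : K →L[ℂ] K) ≤ cfc (⇑f) S := cfc_nonneg fun t _ => hf t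
      have h2 := ((ContinuousLinearMap.nonneg_iff_isPositive _).1 h).inner_nonneg_right x
      exact (Complex.le_def.1 h2).1)

/-- The scalar spectral measure `μ_x` of a self-adjoint operator `S` at the vector `x`: the
regular Borel measure on `ℝ` with `∫ f dμ_x = ⟪x, f(S) x⟫` for all `f ∈ C_c(ℝ)`. -/
def spectralMeasure (S : K →L[ℂ] K) (x : K) : MeasureTheory.Measure ℝ :=
  RealRMK.rieszMeasure (spectralFunctional S x)

open Classical in
/-- The spectral projection `1_B(S)` of a self-adjoint operator `S` for a Borel set `B ⊆ ℝ`: the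
unique bounded operator `P` with `⟪x, P x⟫ = μ_x(B)` for every vector `x`. -/
def spectralProjection (S : K →L[ℂ] K) (B : Set ℝ) : K →L[ℂ] K :=
  if h : ∃ P : K →L[ℂ] K, ∀ x, ⟪x, P x⟫_ℂ = ((spectralMeasure S x).real B : ℂ)
  then h.choose else 0

theorem integral_spectralMeasure (S : K →L[ℂ] K) (x : K) (f : C_c(ℝ, ℝ)) :
    ∫ t, f t ∂(spectralMeasure S x) = (⟪x, (cfc (f : ℝ → ℝ) S) x⟫_ℂ).re :=
  RealRMK.integral_rieszMeasure (spectralFunctional S x) f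





theorem exists_operator_of_tendsto (P : ℕ → K →L[ℂ] K) (h0 : ∀ k, 0 ≤ P k) (h1 : ∀ k, P k ≤ 1)
    (q : K → ℝ) (h : ∀ x, Tendsto (fun k => (⟪x, P k x⟫_ℂ).re) atTop (𝓝 (q x))) :
    ∃ T : K →L[ℂ] K, ∀ x, ⟪x, T x⟫_ℂ = (q x : ℂ) := by
  have hn : ∀ k, ‖P k‖ ≤ 1 := fun k =>
    (CStarAlgebra.norm_le_one_iff_of_nonneg (P k) (h0 k)).2 (h1 k)
  have hq : ∀ x, Tendsto (fun k => ⟪P k x, x⟫_ℂ) atTop (𝓝 (q x : ℂ)) := by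
    intro x
    have := (Complex.continuous_ofReal.tendsto (q x)).comp (h x)
    refine this.congr fun k => ?_
    have hp := (ContinuousLinearMap.nonneg_iff_isPositive _).1 (h0 k)
    have h2 := Complex.le_def.1 (hp.inner_nonneg_right x)
    have h3 : ⟪P k x, x⟫_ℂ = ⟪x, P k x⟫_ℂ := hp.isSymmetric x x
    rw [h3]
    apply Complex.ext
    · simp
    · simpa using h2.2
  have hB : ∀ v w : K, ∃ b : ℂ, Tendsto (fun k => ⟪P k v, w⟫_ℂ) atTop (𝓝 b) := by
    intro v w
    refine ⟨((q (v + w) : ℂ) - q (v - w) - Complex.I * q (v + Complex.I • w)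
        + Complex.I * q (v - Complex.I • w)) / 4, Tendsto.congr (fun k =>
      (inner_map_polarization' (P k : K →ₗ[ℂ] K) v w).symm) ?_⟩
    exact ((((hq _).sub (hq _)).sub ((hq _).const_mul _)).add ((hq _).const_mul _)).div_const 4
  choose B hB using hB
  let F : K →ₗ⋆[ℂ] K →ₗ[ℂ] ℂ := LinearMap.mk₂'ₛₗ (starRingEnd ℂ) (RingHom.id ℂ) B
    (fun v v' w => tendsto_nhds_unique (hB _ _) (by
      simpa [inner_add_left] using (hB v w).add (hB v' w)))
    (fun c v w => tendsto_nhds_unique (hB _ _) (by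
      simpa [inner_smul_left, mul_comm] using (hB v w).const_mul (starRingEnd ℂ c)))
    (fun v w w' => tendsto_nhds_unique (hB _ _) (by
      simpa [inner_add_right] using (hB v w).add (hB v w')))
    (fun c v w => tendsto_nhds_unique (hB _ _) (by
      simpa [inner_smul_right] using (hB v w).const_mul c))
  have hF : ∀ v w, ‖F v w‖ ≤ 1 * ‖v‖ * ‖w‖ := by
    intro v w
    refine le_of_tendsto (hB v w).norm (Eventually.of_forall fun k => ?_)
    refine (norm_inner_le_norm _ _).trans ?_
    gcongr
    exact (P k).le_of_opNorm_le (hn k) v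
  refine ⟨ContinuousLinearMap.adjoint
    (InnerProductSpace.continuousLinearMapOfBilin (F.mkContinuous₂ 1 hF)), fun x => ?_⟩
  rw [ContinuousLinearMap.adjoint_inner_right, InnerProductSpace.continuousLinearMapOfBilin_apply]
  exact tendsto_nhds_unique (hB x x) (hq x)

/-- The piecewise linear cutoff that is `1` on `[l, u]` and `0` at distance at least `1/(k+1)` from
it. -/
def cutoffFun (l u : ℝ) (k : ℕ) : C_c(ℝ, ℝ) where
  toFun t := max 0 (1 - (k + 1) * (max 0 (l - t) + max 0 (t - u)))
  continuous_toFun := by fun_prop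
  hasCompactSupport' := by
    refine HasCompactSupport.of_support_subset_isCompact (isCompact_Icc (a := l - 1) (b := u + 1)) ?_
    intro t ht
    by_contra hc
    apply ht
    have h1 : 1 ≤ max 0 (l - t) + max 0 (t - u) := by
      rw [Set.mem_Icc, not_and_or, not_le, not_le] at hc
      rcases hc with hc | hc
      · linarith [le_max_right 0 (l - t), le_max_left 0 (t - u)]
      · linarith [le_max_left 0 (l - t), le_max_right 0 (t - u)]
    have hk : (0 : ℝ) ≤ k := k.cast_nonneg
    exact max_eq_left (by nlinarith)

theorem cutoffFun_apply (l u : ℝ) (k : ℕ) (t : ℝ) :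
    cutoffFun l u k t = max 0 (1 - (k + 1) * (max 0 (l - t) + max 0 (t - u))) := rfl

theorem cutoffFun_nonneg (l u : ℝ) (k : ℕ) (t : ℝ) : 0 ≤ cutoffFun l u k t := le_max_left _ _

theorem cutoffFun_le_one (l u : ℝ) (k : ℕ) (t : ℝ) : cutoffFun l u k t ≤ 1 := by
  rw [cutoffFun_apply]
  have : 0 ≤ ((k : ℝ) + 1) * (max 0 (l - t) + max 0 (t - u)) := by positivity
  exact max_le zero_le_one (by linarith)

theorem cutoffFun_eq_one {l u : ℝ} (k : ℕ) {t : ℝ} (ht : t ∈ Set.Icc l u) :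
    cutoffFun l u k t = 1 := by
  rw [cutoffFun_apply, max_eq_left (by linarith [ht.1] : l - t ≤ 0),
    max_eq_left (by linarith [ht.2] : t - u ≤ 0)]
  simp

theorem cutoffFun_tendsto (l u t : ℝ) :
    Tendsto (fun k => cutoffFun l u k t) atTop (𝓝 ((Set.Icc l u).indicator 1 t)) := by
  by_cases ht : t ∈ Set.Icc l u
  · simp [ht, cutoffFun_eq_one]
  · rw [Set.indicator_of_notMem ht]
    have hd : 0 < max 0 (l - t) + max 0 (t - u) := by
      rw [Set.mem_Icc, not_and_or, not_le, not_le] at ht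
      rcases ht with hc | hc
      · linarith [le_max_right 0 (l - t), le_max_left 0 (t - u)]
      · linarith [le_max_left 0 (l - t), le_max_right 0 (t - u)]
    obtain ⟨N, hN⟩ := exists_nat_gt (1 / (max 0 (l - t) + max 0 (t - u)))
    refine tendsto_const_nhds.congr' ?_
    filter_upwards [eventually_ge_atTop N] with k hk
    rw [cutoffFun_apply, eq_comm]
    apply max_eq_left
    have h1 : (N : ℝ) ≤ k := by exact_mod_cast hk
    have h2 : 1 < (N : ℝ) * (max 0 (l - t) + max 0 (t - u)) := by
      rwa [div_lt_iff₀ hd] at hN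
    nlinarith

theorem cfc_cutoffFun_eq_one {S : K →L[ℂ] K} (hS : IsSelfAdjoint S) {m : ℕ} (hm : ‖S‖ ≤ m) (k : ℕ) :
    cfc (⇑(cutoffFun (-m) m k)) S = 1 := by
  rw [← cfc_const_one ℝ S]
  refine cfc_congr fun t ht => cutoffFun_eq_one k ?_
  rcases subsingleton_or_nontrivial (K →L[ℂ] K) with h | h
  · simp at ht
  · have := (spectrum.norm_le_norm_of_mem ht).trans hm
    exact abs_le.1 this

theorem spectralMeasure_univ {S : K →L[ℂ] K} (hS : IsSelfAdjoint S) (x : K) :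
    spectralMeasure S x Set.univ = ENNReal.ofReal (‖x‖ ^ 2) := by
  have hL : ∀ m : ℕ, ‖S‖ ≤ m → spectralFunctional S x (cutoffFun (-m) m 0) = ‖x‖ ^ 2 := by
    intro m hm
    change (⟪x, (cfc (⇑(cutoffFun (-m) m 0)) S) x⟫_ℂ).re = _
    rw [cfc_cutoffFun_eq_one hS hm, one_apply_eq_self, inner_self_eq_norm_sq_to_K]
    norm_cast
  obtain ⟨m, hm⟩ := exists_nat_ge ‖S‖
  apply le_antisymm
  · have hU : (⋃ k : ℕ, Set.Icc (-(k : ℝ)) k) = Set.univ := by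
      refine Set.eq_univ_of_forall fun t => ?_
      obtain ⟨k, hk⟩ := exists_nat_ge |t|
      exact Set.mem_iUnion.2 ⟨k, abs_le.1 hk⟩
    have hmono : Monotone fun k : ℕ => Set.Icc (-(k : ℝ)) k := by
      intro i j hij
      have : (i : ℝ) ≤ j := by exact_mod_cast hij
      exact Set.Icc_subset_Icc (by linarith) this
    rw [← hU]
    refine le_of_tendsto (tendsto_measure_iUnion_atTop hmono) ?_
    filter_upwards [eventually_ge_atTop m] with k hk
    have hk' : ‖S‖ ≤ k := hm.trans (by exact_mod_cast hk)
    rw [← hL k hk']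
    exact RealRMK.rieszMeasure_le_of_eq_one _ (cutoffFun_nonneg _ _ _) isCompact_Icc
      fun t ht => cutoffFun_eq_one 0 ht
  · rw [← hL m hm, ← RealRMK.integral_rieszMeasure (spectralFunctional S x),
      integral_eq_lintegral_of_nonneg_ae (Eventually.of_forall (cutoffFun_nonneg _ _ _))
        (cutoffFun _ _ _).continuous.aestronglyMeasurable]
    refine ENNReal.ofReal_toReal_le.trans ?_
    calc _ ≤ ∫⁻ _, 1 ∂(spectralMeasure S x) := lintegral_mono fun t =>
          ENNReal.ofReal_le_one.2 (cutoffFun_le_one _ _ _ t)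
      _ = _ := by simp

theorem isFiniteMeasure_spectralMeasure {S : K →L[ℂ] K} (hS : IsSelfAdjoint S) (x : K) :
    IsFiniteMeasure (spectralMeasure S x) :=
  ⟨by rw [spectralMeasure_univ hS]; exact ENNReal.ofReal_lt_top⟩

theorem nonneg_le_one_of_spectralMeasure {S : K →L[ℂ] K} (hS : IsSelfAdjoint S) {B : Set ℝ}
    {P : K →L[ℂ] K} (hP : ∀ x, ⟪x, P x⟫_ℂ = ((spectralMeasure S x).real B : ℂ)) :
    0 ≤ P ∧ P ≤ 1 := by
  have hc : ∀ x, ⟪P x, x⟫_ℂ = ((spectralMeasure S x).real B : ℂ) := fun x => by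
    rw [← inner_conj_symm, hP, Complex.conj_ofReal]
  refine ⟨(ContinuousLinearMap.nonneg_iff_isPositive _).2
    ((ContinuousLinearMap.isPositive_iff_complex _).2 fun x => ?_), ?_⟩
  · rw [hc]; simp
  · rw [ContinuousLinearMap.le_def, ContinuousLinearMap.isPositive_iff_complex]
    intro x
    have := isFiniteMeasure_spectralMeasure hS x
    have h1 : (spectralMeasure S x).real Set.univ = ‖x‖ ^ 2 := by
      rw [measureReal_def, spectralMeasure_univ hS, ENNReal.toReal_ofReal (by positivity)]
    have h2 : ⟪(1 - P) x, x⟫_ℂ = ((‖x‖ ^ 2 - (spectralMeasure S x).real B : ℝ) : ℂ) := by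
      rw [sub_apply, inner_sub_left, hc, one_apply_eq_self,
        inner_self_eq_norm_sq_to_K]
      push_cast; rfl
    rw [h2]
    refine ⟨by rw [RCLike.re_eq_complex_re, Complex.ofReal_re], ?_⟩
    have h3 : (spectralMeasure S x).real B ≤ (spectralMeasure S x).real Set.univ :=
      measureReal_mono (Set.subset_univ B)
    rw [h1] at h3
    rw [RCLike.re_eq_complex_re, Complex.ofReal_re]
    exact sub_nonneg.2 h3

theorem exists_spectralProjection {S : K →L[ℂ] K} (hS : IsSelfAdjoint S) {B : Set ℝ}
    (hB : MeasurableSet B) :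
    ∃ P : K →L[ℂ] K, ∀ x, ⟪x, P x⟫_ℂ = ((spectralMeasure S x).real B : ℂ) := by
  have hfin := isFiniteMeasure_spectralMeasure hS
  refine MeasurableSpace.induction_on_inter
    (C := fun B _ => ∃ P : K →L[ℂ] K, ∀ x, ⟪x, P x⟫_ℂ = ((spectralMeasure S x).real B : ℂ))
    ((BorelSpace.measurable_eq (α := ℝ)).trans (borel_eq_generateFrom_Icc ℝ))
    (isPiSystem_Icc id id) ⟨0, by simp⟩ ?_ ?_ ?_ B hB
  · rintro _ ⟨l, u, -, rfl⟩
    refine exists_operator_of_tendsto (fun k => cfc (⇑(cutoffFun l u k)) S)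
      (fun k => cfc_nonneg fun t _ => cutoffFun_nonneg _ _ _ t)
      (fun k => cfc_le_one _ _ fun t _ => cutoffFun_le_one _ _ _ t) _ fun x => ?_
    simp_rw [← integral_spectralMeasure]
    rw [← integral_indicator_one measurableSet_Icc]
    refine tendsto_integral_of_dominated_convergence (fun _ => 1)
      (fun k => (cutoffFun l u k).continuous.aestronglyMeasurable) (integrable_const 1)
      (fun k => Eventually.of_forall fun t => ?_)
      (Eventually.of_forall fun t => cutoffFun_tendsto l u t)
    rw [Real.norm_of_nonneg (cutoffFun_nonneg _ _ _ t)]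
    exact cutoffFun_le_one _ _ _ t
  · rintro t ht ⟨P, hP⟩
    refine ⟨1 - P, fun x => ?_⟩
    have h1 : (spectralMeasure S x).real Set.univ = ‖x‖ ^ 2 := by
      rw [measureReal_def, spectralMeasure_univ hS, ENNReal.toReal_ofReal (by positivity)]
    rw [measureReal_compl ht, h1, sub_apply, inner_sub_right, hP, one_apply_eq_self,
        inner_self_eq_norm_sq_to_K]
    push_cast; rfl
  · intro f hd hm hP
    choose P hP using hP
    have hsum : ∀ k x, ⟪x, (∑ i ∈ Finset.range k, P i) x⟫_ℂ
        = ((spectralMeasure S x).real (⋃ i ∈ Finset.range k, f i) : ℂ) := by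
      intro k x
      rw [measureReal_biUnion_finset (fun i _ j _ hij => hd hij) fun i _ => hm i]
      simp [hP]
    refine exists_operator_of_tendsto (fun k => ∑ i ∈ Finset.range k, P i)
      (fun k => (nonneg_le_one_of_spectralMeasure hS (hsum k)).1)
      (fun k => (nonneg_le_one_of_spectralMeasure hS (hsum k)).2) _ fun x => ?_
    have hU : (⋃ i, f i) = ⋃ k, ⋃ i ∈ Finset.range k, f i := by
      ext t
      simp only [Set.mem_iUnion, Finset.mem_range]
      exact ⟨fun ⟨i, hi⟩ => ⟨i + 1, i, Nat.lt_succ_self i, hi⟩, fun ⟨_, i, _, hi⟩ => ⟨i, hi⟩⟩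
    have hmono : Monotone fun k => ⋃ i ∈ Finset.range k, f i := fun a b hab =>
      Set.biUnion_subset_biUnion_left fun i hi => by
        simp only [Finset.coe_range, Set.mem_Iio] at hi ⊢
        exact lt_of_lt_of_le hi hab
    rw [hU]
    have ht := (ENNReal.tendsto_toReal (measure_ne_top (spectralMeasure S x) _)).comp
      (tendsto_measure_iUnion_atTop (μ := spectralMeasure S x) hmono)
    refine ht.congr fun k => ?_
    rw [hsum]; rfl

theorem inner_spectralProjection {S : K →L[ℂ] K} (hS : IsSelfAdjoint S) {B : Set ℝ}
    (hB : MeasurableSet B) (x : K) :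
    ⟪x, spectralProjection S B x⟫_ℂ = ((spectralMeasure S x).real B : ℂ) := by
  have h := exists_spectralProjection hS hB
  rw [spectralProjection, dif_pos h]
  exact h.choose_spec x

end Spectral

section Polar

variable {H K : Type*} [NormedAddCommGroup H] [InnerProductSpace ℂ H] [CompleteSpace H]
  [NormedAddCommGroup K] [InnerProductSpace ℂ K] [CompleteSpace K]

/-- The absolute value `|T| = (T* T)^{1/2}` of a bounded operator between Hilbert spaces. -/
def absOp (T : H →L[ℂ] K) : H →L[ℂ] H :=
  CFC.sqrt (ContinuousLinearMap.adjoint T ∘L T)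

/-- A partial isometry: isometric on the orthogonal complement of its kernel. -/
def IsPartialIsometry (v : H →L[ℂ] K) : Prop :=
  ∀ x ∈ (LinearMap.ker (v : H →ₗ[ℂ] K))ᗮ, ‖v x‖ = ‖x‖

/-- `T = v|T|` is the polar decomposition of `T`: `v` is the partial isometry with `T = v|T|` and
`ker v = ker T`. -/
structure IsPolarDecomposition (T v : H →L[ℂ] K) : Prop where
  partialIsometry : IsPartialIsometry v
  eq_comp : T = v ∘L absOp T
  ker_eq : LinearMap.ker (v : H →ₗ[ℂ] K) = LinearMap.ker (T : H →ₗ[ℂ] K)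

end Polar

section Columns

variable {A : Type*} [CStarAlgebra A]
  {H : Type*} [NormedAddCommGroup H] [InnerProductSpace ℂ H] [CompleteSpace H]

/-- `A^n`, identified with `M_{n,1}(A)`. -/
abbrev Column (n : ℕ) (A : Type*) : Type _ := CStarMatrix (Fin n) (Fin 1) A

/-- The norm of `M_{n,1}(A)` is `‖a‖² = ‖a* a‖`. -/
theorem norm_sq_column {A : Type*} [CStarAlgebra A] [PartialOrder A] [StarOrderedRing A] {n : ℕ}
    (a : Column n A) : ‖a‖ ^ 2 = ‖∑ i, star (a i 0) * a i 0‖ := by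
  let b : WithCStarModule A (Fin n → A) := (WithCStarModule.equiv A _).symm fun i => star (a i 0)
  have hbi : ∀ i, b i = star (a i 0) := fun i => rfl
  have hb : ‖b‖ ^ 2 = ‖∑ i, star (a i 0) * a i 0‖ := by
    rw [WithCStarModule.pi_norm_sq]
    simp [WithCStarModule.inner_def, hbi]
  have hv : ∀ v : WithCStarModule A (Fin n → A), ‖CStarMatrix.toCLM a v‖ = ‖⟪b, v⟫_A‖ := by
    intro v
    rw [← sq_eq_sq₀ (norm_nonneg _) (norm_nonneg _), WithCStarModule.pi_norm_sq,
      WithCStarModule.pi_inner]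
    simp [CStarMatrix.toCLM_apply, WithCStarModule.inner_def, hbi, Matrix.vecMul, dotProduct, sq]
    rw [← CStarRing.norm_self_mul_star]
    simp
  rw [← hb]
  congr 1
  apply le_antisymm
  · rw [CStarMatrix.norm_def]
    refine ContinuousLinearMap.opNorm_le_bound _ (norm_nonneg _) fun v => ?_
    rw [hv]
    exact CStarModule.norm_inner_le _
  · have h := (CStarMatrix.toCLM a).le_opNorm b
    rw [hv, ← CStarModule.norm_sq_eq A, ← CStarMatrix.norm_def, sq] at h
    rcases (norm_nonneg b).eq_or_lt with h0 | h0
    · rw [← h0]; exact norm_nonneg _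
    · exact le_of_mul_le_mul_right h h0

/-- `Lg_n(A)`: the columns whose entries generate `A` as a left ideal,
`A = A a₁ + ⋯ + A aₙ`. -/
def Lg (n : ℕ) (A : Type*) [CStarAlgebra A] : Set (Column n A) :=
  {a | Ideal.span (Set.range fun i => a i 0) = ⊤}

/-- The Hilbert space direct sum `H^n`. -/
abbrev HilbertPow (n : ℕ) (H : Type*) [NormedAddCommGroup H] : Type _ := PiLp 2 fun _ : Fin n => H

/-- A column `a ∈ A^n` as an operator `H → H^n`, `ξ ↦ (π(a₁) ξ, …, π(aₙ) ξ)`. -/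
def columnOp (π : A →⋆ₐ[ℂ] (H →L[ℂ] H)) {n : ℕ} (a : Column n A) : H →L[ℂ] HilbertPow n H :=
  (PiLp.continuousLinearEquiv 2 ℂ (fun _ : Fin n => H)).symm.toContinuousLinearMap ∘L
    ContinuousLinearMap.pi fun i => π (a i 0)

/-- `f_λ = 1_{[0, λ]}(|a*|)`, the spectral projection of `|a*|` on `H^n` for the interval
`[0, λ]`. -/
def lowerProj (π : A →⋆ₐ[ℂ] (H →L[ℂ] H)) {n : ℕ} (a : Column n A) (lam : ℝ) :
    HilbertPow n H →L[ℂ] HilbertPow n H :=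
  spectralProjection (absOp (ContinuousLinearMap.adjoint (columnOp π a))) (Set.Icc 0 lam)

end Columns

end StableRank

end

open StableRank

noncomputable section

namespace StableRank

/-! ### Spectral projections against the continuous functional calculus -/

section SpectralSubspaces

open Filter Topology MeasureTheory

variable {K : Type*} [NormedAddCommGroup K] [InnerProductSpace ℂ K] [CompleteSpace K]

/-! Write `r = 1 - f_λ`. The spectral projection and `v` need not come from `A`, so each is
multiplied by a continuous function that brings it back to a column over `A`.

Suppose `r v = r s` with `s` in `Lg`. For `μ > λ` and `φ(t) = (t - μ)₊`, the operator `φ(|a*|)`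
kills `f_λ`, so `φ(|a*|) s = φ(|a*|) v = v φ(|a|)`, which is within `μ` of `a = v|a|`. With `φ(t) =
p(t) t²` one has `φ(|a*|) = a p(|a|) a*`, a matrix over `A`. For `ε > 0` the matrix `ε + a p(|a|)
a*` is invertible, so `(ε + φ(|a*|)) s` is in `Lg` and nearly within `μ` of `a`. This is
`infDist_Lg_le`, resting on `smul_add_colMul_mem_Lg`.

Conversely, let `b` in `Lg` satisfy `‖a - b‖ < λ`. Put `g(t) = 1 / max(t, λ)`, `w = a g(|a|)`, `c =
b g(|a|)`. Then `‖c - w‖ < 1`, `r w = r v` and `r w w* = r`, so `r c = r w (1 + w*(c - w))`. The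
last factor is an invertible `u` in `A`, and `s = c u⁻¹` works. This is `exists_mem_Lg_of_dist_lt`:
every `λ` above the distance lies in the set. -/

theorem tendsto_inner_cfc_cutoffFun {S : K →L[ℂ] K} (hS : IsSelfAdjoint S) (l u : ℝ) (x : K) :
    Tendsto (fun k => (⟪x, cfc (⇑(cutoffFun l u k)) S x⟫_ℂ).re) atTop
      (𝓝 (⟪x, spectralProjection S (Set.Icc l u) x⟫_ℂ).re) := by
  have := isFiniteMeasure_spectralMeasure hS x
  rw [inner_spectralProjection hS measurableSet_Icc, Complex.ofReal_re,
    ← integral_indicator_one measurableSet_Icc]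
  simp_rw [← integral_spectralMeasure]
  refine tendsto_integral_of_dominated_convergence (fun _ => 1)
    (fun k => (cutoffFun l u k).continuous.aestronglyMeasurable) (integrable_const 1)
    (fun k => Eventually.of_forall fun t => ?_)
    (Eventually.of_forall fun t => cutoffFun_tendsto l u t)
  rw [Real.norm_of_nonneg (cutoffFun_nonneg _ _ _ t)]
  exact cutoffFun_le_one _ _ _ t

/-- The form at `G x` is `‖E^{1/2} G x‖²`. This lets the products below be computed from quadratic
forms and `0 ≤ P ≤ 1` alone, without idempotence of the spectral projection. -/
theorem nonneg_mul_eq_zero_of_inner_eq_zero {E G : K →L[ℂ] K} (hE : 0 ≤ E)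
    (h : ∀ x, (⟪G x, E (G x)⟫_ℂ).re = 0) : E * G = 0 := by
  have hs : CFC.sqrt E * CFC.sqrt E = E := CFC.sqrt_mul_sqrt_self E hE
  have hsa : (CFC.sqrt E).IsSymmetric :=
    ((ContinuousLinearMap.nonneg_iff_isPositive _).1 (CFC.sqrt_nonneg E)).isSymmetric
  ext x
  have h1 : (⟪CFC.sqrt E (G x), CFC.sqrt E (G x)⟫_ℂ).re = 0 := by
    have h2 : ⟪CFC.sqrt E (G x), CFC.sqrt E (G x)⟫_ℂ = ⟪G x, CFC.sqrt E (CFC.sqrt E (G x))⟫_ℂ :=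
      hsa _ _
    rw [h2, ← mul_apply_eq_comp, hs, h]
  have h3 : CFC.sqrt E (G x) = 0 := by
    have : RCLike.re ⟪CFC.sqrt E (G x), CFC.sqrt E (G x)⟫_ℂ = 0 := h1
    rw [inner_self_eq_norm_sq] at this
    simpa using this
  rw [mul_apply_eq_comp, ← hs, mul_apply_eq_comp, h3]
  simp

theorem spectralProjection_nonneg_le_one {S : K →L[ℂ] K} (hS : IsSelfAdjoint S) {B : Set ℝ}
    (hB : MeasurableSet B) : 0 ≤ spectralProjection S B ∧ spectralProjection S B ≤ 1 :=
  nonneg_le_one_of_spectralMeasure hS (inner_spectralProjection hS hB)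

theorem inner_cfc_cfc_cfc {S : K →L[ℂ] K} {φ g : ℝ → ℝ} (hφ : Continuous φ)
    (hg : Continuous g) (x : K) :
    ⟪cfc φ S x, cfc g S (cfc φ S x)⟫_ℂ = ⟪x, cfc (fun t => φ t * (g t * φ t)) S x⟫_ℂ := by
  have hsym : (cfc φ S).IsSymmetric :=
    ContinuousLinearMap.isSelfAdjoint_iff_isSymmetric.1 (cfc_predicate φ S)
  rw [cfc_mul φ (fun t => g t * φ t) S, cfc_mul g φ S]
  exact hsym _ _

/-- `φ(S) 1_{[l,u]}(S) = 0` if `φ` vanishes on the part of the spectrum below `u + δ`. -/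
theorem cfc_mul_spectralProjection_eq_zero {S : K →L[ℂ] K} (hS : IsSelfAdjoint S) {l u δ : ℝ}
    (hδ : 0 < δ) {φ : ℝ → ℝ} (hφ : Continuous φ) (h : ∀ t ≤ u + δ, φ t = 0) :
    cfc φ S * spectralProjection S (Set.Icc l u) = 0 := by
  have h0 := (spectralProjection_nonneg_le_one hS (measurableSet_Icc (a := l) (b := u))).1
  have key : spectralProjection S (Set.Icc l u) * cfc φ S = 0 := by
    refine nonneg_mul_eq_zero_of_inner_eq_zero h0 fun x => ?_
    refine tendsto_nhds_unique (tendsto_inner_cfc_cutoffFun hS l u _)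
      (tendsto_const_nhds.congr' ?_)
    -- The cutoffs have ramps of width `1/(k+1)`; once this is below `δ` they vanish wherever `φ`
    -- does not.
    obtain ⟨N, hN⟩ := exists_nat_gt (1 / δ)
    filter_upwards [eventually_ge_atTop N] with k hk
    rw [inner_cfc_cfc_cfc (g := ⇑(cutoffFun l u k)) hφ (cutoffFun l u k).continuous]
    have hz : (fun t => φ t * (cutoffFun l u k t * φ t)) = fun _ => 0 := by
      funext t
      rcases le_or_gt t (u + δ) with ht | ht
      · simp [h t ht]
      · have hk' : (N : ℝ) ≤ k := by exact_mod_cast hk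
        have h1 : 1 < (N : ℝ) * δ := by rwa [div_lt_iff₀ hδ] at hN
        have h2 : cutoffFun l u k t = 0 := by
          rw [cutoffFun_apply]
          apply max_eq_left
          have h3 : δ ≤ max 0 (l - t) + max 0 (t - u) := by
            linarith [le_max_right 0 (t - u), le_max_left 0 (l - t)]
          nlinarith
        simp [h2]
    rw [hz, cfc_const_zero]
    simp
  have h1 := congrArg star key
  rwa [star_mul, star_zero, (IsSelfAdjoint.of_nonneg h0).star_eq,
    (cfc_predicate φ S : IsSelfAdjoint _).star_eq] at h1

/-- `(1 - 1_{[l,u]}(S)) φ(S) = 0` if `φ` vanishes on the part of the spectrum outside `[l,u]`. -/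
theorem one_sub_spectralProjection_mul_cfc_eq_zero {S : K →L[ℂ] K} (hS : IsSelfAdjoint S)
    {l u : ℝ} {φ : ℝ → ℝ} (hφ : Continuous φ)
    (h : ∀ t ∈ spectrum ℝ S, t ∉ Set.Icc l u → φ t = 0) :
    (1 - spectralProjection S (Set.Icc l u)) * cfc φ S = 0 := by
  have h1 := (spectralProjection_nonneg_le_one hS (measurableSet_Icc (a := l) (b := u))).2
  refine nonneg_mul_eq_zero_of_inner_eq_zero (sub_nonneg.2 h1) fun x => ?_
  rw [sub_apply, inner_sub_right, Complex.sub_re, sub_eq_zero]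
  -- Every cutoff is exactly `1` on `[l, u]`, the only part of the spectrum where `φ` can be
  -- nonzero, so the sequence is constant and no gap `δ` is needed.
  refine tendsto_nhds_unique (tendsto_const_nhds.congr fun k => ?_)
    (tendsto_inner_cfc_cutoffFun hS l u _)
  rw [inner_cfc_cfc_cfc (g := ⇑(cutoffFun l u k)) hφ (cutoffFun l u k).continuous, ← cfc_const_one ℝ S,
    inner_cfc_cfc_cfc hφ continuous_const]
  congr 3
  refine cfc_congr fun t ht => ?_
  by_cases ht' : t ∈ Set.Icc l u
  · simp [cutoffFun_eq_one k ht']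
  · simp [h t ht ht']

end SpectralSubspaces

/-! ### Intertwining relations pass to continuous functions -/

section Intertwining

variable {H K : Type*} [NormedAddCommGroup H] [InnerProductSpace ℂ H]
  [NormedAddCommGroup K] [InnerProductSpace ℂ K]

theorem comp_aeval_eq_of_comp_eq {X : H →L[ℂ] K} {Q : H →L[ℂ] H} {R : K →L[ℂ] K}
    (h : X ∘L Q = R ∘L X) (p : Polynomial ℝ) :
    X ∘L Polynomial.aeval Q p = Polynomial.aeval R p ∘L X := by
  induction p using Polynomial.induction_on' with
  | add p q hp hq => rw [map_add, map_add, ContinuousLinearMap.comp_add, hp, hq,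
      ContinuousLinearMap.add_comp]
  | monomial n c =>
    have hpow : X ∘L (Q ^ n) = (R ^ n) ∘L X := by
      induction n with
      | zero => rfl
      | succ n ih =>
        calc X ∘L (Q ^ (n + 1)) = (X ∘L (Q ^ n)) ∘L Q := by rw [pow_succ]; rfl
          _ = (R ^ n) ∘L (X ∘L Q) := by rw [ih]; rfl
          _ = (R ^ (n + 1)) ∘L X := by rw [h, pow_succ]; rfl
    rw [Polynomial.aeval_monomial, Polynomial.aeval_monomial, ← Algebra.smul_def,
      ← Algebra.smul_def, ContinuousLinearMap.comp_smul, hpow, ContinuousLinearMap.smul_comp]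

variable [CompleteSpace H] [CompleteSpace K]

theorem norm_aeval_sub_cfc_le {S : K →L[ℂ] K} (hS : IsSelfAdjoint S) {r ε : ℝ} (hr : ‖S‖ ≤ r)
    (hε : 0 ≤ ε) {g : ℝ → ℝ} (hg : Continuous g) {p : Polynomial ℝ}
    (hp : ∀ t ∈ Set.Icc (-r) r, |p.eval t - g t| ≤ ε) :
    ‖Polynomial.aeval S p - cfc g S‖ ≤ ε := by
  rw [← cfc_polynomial p S, ← cfc_sub (fun x => p.eval x) g S]
  refine norm_cfc_le hε fun t ht => hp t ?_
  rcases subsingleton_or_nontrivial (K →L[ℂ] K) with hs | hs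
  · simp at ht
  · exact abs_le.1 ((spectrum.norm_le_norm_of_mem ht).trans hr)

/-- If `X Q = R X` for self-adjoint `Q` and `R`, then `X g(Q) = g(R) X` for continuous `g`. -/
theorem comp_cfc_eq_of_comp_eq {X : H →L[ℂ] K} {Q : H →L[ℂ] H} {R : K →L[ℂ] K}
    (hQ : IsSelfAdjoint Q) (hR : IsSelfAdjoint R) (h : X ∘L Q = R ∘L X) {g : ℝ → ℝ}
    (hg : Continuous g) : X ∘L cfc g Q = cfc g R ∘L X := by
  rw [← sub_eq_zero, ← norm_le_zero_iff]
  refine le_of_forall_pos_le_add fun ε hε => ?_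
  -- One polynomial serves both operators, on an interval containing both spectra; the `+ 1` covers
  -- `X = 0`.
  have hδ : 0 < ε / (2 * (‖X‖ + 1)) := by positivity
  obtain ⟨p, hp⟩ := exists_polynomial_near_of_continuousOn (-max ‖Q‖ ‖R‖) (max ‖Q‖ ‖R‖) g
    hg.continuousOn _ hδ
  have e : X ∘L cfc g Q - cfc g R ∘L X
      = (Polynomial.aeval R p - cfc g R) ∘L X - X ∘L (Polynomial.aeval Q p - cfc g Q) := by
    rw [ContinuousLinearMap.comp_sub, ContinuousLinearMap.sub_comp, comp_aeval_eq_of_comp_eq h]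
    abel
  rw [e, zero_add]
  calc _ ≤ ‖Polynomial.aeval R p - cfc g R‖ * ‖X‖ + ‖X‖ * ‖Polynomial.aeval Q p - cfc g Q‖ :=
        (norm_sub_le _ _).trans (add_le_add (ContinuousLinearMap.opNorm_comp_le _ _)
          (ContinuousLinearMap.opNorm_comp_le _ _))
    _ ≤ ε / (2 * (‖X‖ + 1)) * (‖X‖ + 1) + (‖X‖ + 1) * (ε / (2 * (‖X‖ + 1))) := by
        gcongr
        · exact norm_aeval_sub_cfc_le hR (le_max_right _ _) hδ.le hg fun t ht => (hp t ht).le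
        · linarith
        · linarith
        · exact norm_aeval_sub_cfc_le hQ (le_max_left _ _) hδ.le hg fun t ht => (hp t ht).le
    _ = ε := by field_simp; ring

end Intertwining

/-! ### Polar decomposition -/

section Polar

variable {H K : Type*} [NormedAddCommGroup H] [InnerProductSpace ℂ H] [CompleteSpace H]
  [NormedAddCommGroup K] [InnerProductSpace ℂ K]

theorem IsPartialIsometry.norm_le_one {v : H →L[ℂ] K} (hv : IsPartialIsometry v) : ‖v‖ ≤ 1 := by
  refine v.opNorm_le_bound zero_le_one fun x => ?_
  let N := LinearMap.ker (v : H →ₗ[ℂ] K)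
  have : CompleteSpace N := (ContinuousLinearMap.isClosed_ker v).completeSpace_coe
  obtain ⟨y, hy, z, hz, rfl⟩ := N.exists_add_mem_mem_orthogonal x
  have hy' : v y = 0 := hy
  have horth : ⟪y, z⟫_ℂ = 0 := hz y hy
  rw [map_add, hy', zero_add, hv z hz, one_mul]
  have := norm_add_sq_eq_norm_sq_add_norm_sq_of_inner_eq_zero y z horth
  nlinarith [norm_nonneg (y + z), norm_nonneg z, norm_nonneg y]

variable [CompleteSpace K]

open ContinuousLinearMap (adjoint)

theorem absOp_nonneg (T : H →L[ℂ] K) : 0 ≤ absOp T := CFC.sqrt_nonneg _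

theorem absOp_mul_self (T : H →L[ℂ] K) : absOp T * absOp T = adjoint T ∘L T :=
  CFC.sqrt_mul_sqrt_self _ ((ContinuousLinearMap.nonneg_iff_isPositive _).2
    (ContinuousLinearMap.isPositive_adjoint_comp_self T))

theorem absOp_apply_eq_zero {T : H →L[ℂ] K} {x : H} (hx : T x = 0) : absOp T x = 0 := by
  have hs : (absOp T).IsSymmetric :=
    ((ContinuousLinearMap.nonneg_iff_isPositive _).1 (absOp_nonneg T)).isSymmetric
  have h : ⟪absOp T x, absOp T x⟫_ℂ = ⟪x, (absOp T * absOp T) x⟫_ℂ := hs _ _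
  rw [absOp_mul_self, ContinuousLinearMap.comp_apply, hx] at h
  simpa using h

/-- The initial projection `v* v` of a partial isometry fixes `(ker v)ᗮ`. -/
theorem IsPartialIsometry.adjoint_apply_apply {v : H →L[ℂ] K} (hv : IsPartialIsometry v) {x : H}
    (hx : x ∈ (LinearMap.ker (v : H →ₗ[ℂ] K))ᗮ) : adjoint v (v x) = x := by
  have h1 : ‖adjoint v (v x)‖ ≤ ‖x‖ := by
    calc _ ≤ ‖adjoint v‖ * ‖v x‖ := (adjoint v).le_opNorm _
      _ ≤ 1 * ‖x‖ := by
          rw [hv x hx, LinearIsometryEquiv.norm_map]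
          gcongr
          exact hv.norm_le_one
      _ = ‖x‖ := one_mul _
  have h2 : RCLike.re ⟪adjoint v (v x), x⟫_ℂ = ‖x‖ ^ 2 := by
    rw [ContinuousLinearMap.adjoint_inner_left, inner_self_eq_norm_sq, hv x hx]
  have h3 : ‖adjoint v (v x) - x‖ ^ 2 ≤ 0 := by
    rw [@norm_sub_sq ℂ, h2]
    nlinarith [norm_nonneg (adjoint v (v x)), norm_nonneg x]
  rw [← sub_eq_zero, ← norm_le_zero_iff]
  nlinarith [norm_nonneg (adjoint v (v x) - x)]

variable {T v : H →L[ℂ] K}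

/-- The range of `|T|` is orthogonal to `ker T = ker v`, and `v* v` fixes `(ker v)ᗮ`. -/
theorem IsPolarDecomposition.adjoint_comp_comp_absOp (h : IsPolarDecomposition T v) :
    adjoint v ∘L v ∘L absOp T = absOp T := by
  have hs : (absOp T).IsSymmetric :=
    ((ContinuousLinearMap.nonneg_iff_isPositive _).1 (absOp_nonneg T)).isSymmetric
  ext x
  refine h.partialIsometry.adjoint_apply_apply ?_
  rw [h.ker_eq]
  intro y hy
  have h1 : ⟪absOp T y, x⟫_ℂ = ⟪y, absOp T x⟫_ℂ := hs _ _
  exact h1.symm.trans (by rw [absOp_apply_eq_zero hy, inner_zero_left])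

theorem IsPolarDecomposition.absOp_comp_adjoint_comp (h : IsPolarDecomposition T v) :
    absOp T ∘L adjoint v ∘L v = absOp T := by
  have h1 := congrArg adjoint h.adjoint_comp_comp_absOp
  simpa [ContinuousLinearMap.adjoint_comp, ContinuousLinearMap.comp_assoc,
    (IsSelfAdjoint.of_nonneg (absOp_nonneg T)).adjoint_eq] using h1

theorem IsPolarDecomposition.adjoint_eq (h : IsPolarDecomposition T v) :
    adjoint T = absOp T ∘L adjoint v := by
  conv_lhs => rw [h.eq_comp]
  rw [ContinuousLinearMap.adjoint_comp, (IsSelfAdjoint.of_nonneg (absOp_nonneg T)).adjoint_eq]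

/-- `|T*| = v |T| v*`. -/
theorem IsPolarDecomposition.absOp_adjoint (h : IsPolarDecomposition T v) :
    absOp (adjoint T) = v ∘L absOp T ∘L adjoint v := by
  refine CFC.sqrt_unique ?_ ?_
  · rw [ContinuousLinearMap.adjoint_adjoint, h.adjoint_eq]
    calc (v ∘L absOp T ∘L adjoint v) * (v ∘L absOp T ∘L adjoint v)
        = v ∘L absOp T ∘L (adjoint v ∘L v ∘L absOp T) ∘L adjoint v := rfl
      _ = (v ∘L absOp T) ∘L absOp T ∘L adjoint v := by rw [h.adjoint_comp_comp_absOp]; rfl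
      _ = T ∘L absOp T ∘L adjoint v := by rw [← h.eq_comp]
  · exact (ContinuousLinearMap.nonneg_iff_isPositive _).2
      (((ContinuousLinearMap.nonneg_iff_isPositive _).1 (absOp_nonneg T)).conj_adjoint v)

theorem IsPolarDecomposition.comp_absOp (h : IsPolarDecomposition T v) :
    v ∘L absOp T = absOp (adjoint T) ∘L v := by
  rw [h.absOp_adjoint, ContinuousLinearMap.comp_assoc, ContinuousLinearMap.comp_assoc,
    h.absOp_comp_adjoint_comp]

theorem IsPolarDecomposition.absOp_adjoint_comp (h : IsPolarDecomposition T v) :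
    absOp (adjoint T) ∘L v ∘L adjoint v = absOp (adjoint T) := by
  rw [← ContinuousLinearMap.comp_assoc, ← h.comp_absOp, h.absOp_adjoint,
    ContinuousLinearMap.comp_assoc]

theorem IsPolarDecomposition.comp_cfc (h : IsPolarDecomposition T v) {g : ℝ → ℝ}
    (hg : Continuous g) : v ∘L cfc g (absOp T) = cfc g (absOp (adjoint T)) ∘L v :=
  comp_cfc_eq_of_comp_eq (IsSelfAdjoint.of_nonneg (absOp_nonneg T))
    (IsSelfAdjoint.of_nonneg (absOp_nonneg (adjoint T))) h.comp_absOp hg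

end Polar

/-! ### Columns over `A` and their operators -/

section Columns

open ContinuousLinearMap (adjoint)

variable {A : Type*} [CStarAlgebra A]
  {H : Type*} [NormedAddCommGroup H] [InnerProductSpace ℂ H] [CompleteSpace H] {n : ℕ}

theorem mem_Lg_iff {a : Column n A} : a ∈ Lg n A ↔ ∃ x : Fin n → A, ∑ i, x i * a i 0 = 1 := by
  rw [Lg, Set.mem_ofPred_eq, Ideal.eq_top_iff_one, Ideal.mem_span_range_iff_exists_fun]

/-- `a* b = ∑ aᵢ* bᵢ` for columns `a`, `b`. -/
def colInner (a b : Column n A) : A := ∑ i, star (a i 0) * b i 0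

theorem colInner_self_nonneg [PartialOrder A] [StarOrderedRing A] (a : Column n A) :
    0 ≤ colInner a a :=
  Finset.sum_nonneg fun i _ => star_mul_self_nonneg (a i 0)

/-- The column `a c` with entries `aᵢ c`. -/
def colMul (a : Column n A) (c : A) : Column n A := fun i _ => a i 0 * c

theorem Lg_nonempty (hn : 1 ≤ n) : (Lg n A).Nonempty := by
  refine ⟨fun _ _ => 1, mem_Lg_iff.2 ⟨Pi.single ⟨0, hn⟩ 1, ?_⟩⟩
  simp

theorem colMul_mem_Lg {a : Column n A} (ha : a ∈ Lg n A) {c d : A} (h : d * c = 1) :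
    colMul a c ∈ Lg n A := by
  obtain ⟨x, hx⟩ := mem_Lg_iff.1 ha
  refine mem_Lg_iff.2 ⟨fun i => d * x i, ?_⟩
  calc ∑ i, d * x i * (a i 0 * c) = d * (∑ i, x i * a i 0) * c := by
        rw [Finset.mul_sum, Finset.sum_mul]
        exact Finset.sum_congr rfl fun i _ => by noncomm_ring
    _ = 1 := by rw [hx, mul_one, h]

/-- `(ε + a p a*) s` is left invertible when `s` is and `q (ε + a* a p) = p`. -/
theorem smul_add_colMul_mem_Lg {s : Column n A} (hs : s ∈ Lg n A) (a : Column n A) {p q : A}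
    {ε : ℝ} (hε : ε ≠ 0) (h : ε • q + q * colInner a a * p = p) :
    (ε • s + colMul a (p * colInner a s) : Column n A) ∈ Lg n A := by
  obtain ⟨x, hx⟩ := mem_Lg_iff.1 hs
  set X := ∑ i, x i * a i 0 with hX
  -- This row is `x (ε + a p a*)⁻¹`, the inverse being `ε⁻¹ (1 - a q a*)`, where `x` is a row with
  -- `x s = 1` and `X = x a`.
  refine mem_Lg_iff.2 ⟨fun i => ε⁻¹ • (x i - X * q * star (a i 0)), ?_⟩
  have e : ∑ i, (ε⁻¹ • (x i - X * q * star (a i 0))) * (ε • s + colMul a (p * colInner a s)) i 0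
      = ε⁻¹ • (ε • ∑ i, x i * s i 0 + X * (p * colInner a s)
        - (ε • (X * q * colInner a s) + X * q * colInner a a * (p * colInner a s))) := by
    change ∑ i, (ε⁻¹ • (x i - X * q * star (a i 0))) * (ε • s i 0 + a i 0 * (p * colInner a s)) = _
    have h1 : X * (p * colInner a s) = ∑ i, x i * a i 0 * (p * colInner a s) := by
      rw [hX, Finset.sum_mul]
    have h2 : ε • (X * q * colInner a s) = ∑ i, ε • (X * q * (star (a i 0) * s i 0)) := by
      conv_lhs => rw [colInner, Finset.mul_sum, Finset.smul_sum]
    have h3 : X * q * colInner a a * (p * colInner a s)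
        = ∑ i, X * q * (star (a i 0) * a i 0) * (p * colInner a s) := by
      rw [← Finset.sum_mul, ← Finset.mul_sum]; rfl
    rw [h1, h2, h3, Finset.smul_sum, ← Finset.sum_add_distrib, ← Finset.sum_add_distrib,
      ← Finset.sum_sub_distrib, Finset.smul_sum]
    refine Finset.sum_congr rfl fun i _ => ?_
    rw [smul_mul_assoc]
    congr 1
    rw [sub_mul, mul_add, mul_add, mul_smul_comm, mul_smul_comm]
    simp only [mul_assoc]
  refine e.trans ?_
  have h4 : ε • (X * q * colInner a s) + X * q * colInner a a * (p * colInner a s)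
      = X * (p * colInner a s) := by
    calc _ = X * (ε • q + q * colInner a a * p) * colInner a s := by
          rw [mul_add, add_mul, mul_smul_comm, smul_mul_assoc]
          simp only [mul_assoc]
      _ = _ := by rw [h, mul_assoc]
  rw [h4, add_sub_cancel_right, hx, smul_smul, inv_mul_cancel₀ hε, one_smul]

variable (π : A →⋆ₐ[ℂ] (H →L[ℂ] H))

theorem columnOp_apply (a : Column n A) (ξ : H) (i : Fin n) : columnOp π a ξ i = π (a i 0) ξ := rfl

theorem columnOp_colMul (a : Column n A) (c : A) :
    columnOp π (colMul a c) = columnOp π a ∘L π c := by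
  ext ξ i
  simp [columnOp_apply, colMul]

theorem columnOp_add (a b : Column n A) : columnOp π (a + b) = columnOp π a + columnOp π b := by
  ext ξ i
  simp [columnOp_apply]

theorem columnOp_sub (a b : Column n A) : columnOp π (a - b) = columnOp π a - columnOp π b := by
  ext ξ i
  simp [columnOp_apply]

theorem columnOp_smul (r : ℝ) (a : Column n A) : columnOp π (r • a) = r • columnOp π a := by
  ext ξ i
  have : π (r • a i 0) = r • π (a i 0) := by
    rw [← Complex.coe_smul, map_smul, Complex.coe_smul]
  simp [columnOp_apply, this]

theorem adjoint_columnOp_comp (a b : Column n A) :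
    adjoint (columnOp π a) ∘L columnOp π b = π (colInner a b) := by
  ext ξ
  refine ext_inner_left ℂ fun η => ?_
  rw [ContinuousLinearMap.comp_apply, ContinuousLinearMap.adjoint_inner_right, PiLp.inner_apply,
    colInner, map_sum, sum_apply, inner_sum]
  refine Finset.sum_congr rfl fun i _ => ?_
  rw [columnOp_apply, columnOp_apply, map_mul, map_star, mul_apply_eq_comp,
    ContinuousLinearMap.star_eq_adjoint, ContinuousLinearMap.adjoint_inner_right]

/-- By the C*-identity both squared norms are norms of `a* a`, and an injective *-homomorphism is
isometric. -/
theorem norm_columnOp [PartialOrder A] [StarOrderedRing A] (hπ : Function.Injective π)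
    (a : Column n A) : ‖columnOp π a‖ = ‖a‖ := by
  refine (sq_eq_sq₀ (norm_nonneg (columnOp π a)) (norm_nonneg a)).1 ?_
  rw [norm_sq_column, sq,
    ← ContinuousLinearMap.norm_adjoint_comp_self, adjoint_columnOp_comp,
    NonUnitalStarAlgHom.norm_map π hπ]
  rfl

theorem absOp_columnOp [PartialOrder A] [StarOrderedRing A] (a : Column n A) :
    absOp (columnOp π a) = π (CFC.sqrt (colInner a a)) := by
  refine CFC.sqrt_unique ?_ (map_nonneg π (CFC.sqrt_nonneg _))
  rw [← map_mul, CFC.sqrt_mul_sqrt_self _ (colInner_self_nonneg a), adjoint_columnOp_comp]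

theorem map_cfc_sqrt [PartialOrder A] [StarOrderedRing A] (a : Column n A) {g : ℝ → ℝ}
    (hg : Continuous g) :
    π (cfc g (CFC.sqrt (colInner a a))) = cfc g (absOp (columnOp π a)) := by
  rw [absOp_columnOp]
  have h := IsSelfAdjoint.of_nonneg (CFC.sqrt_nonneg (colInner a a))
  exact StarAlgHomClass.map_cfc (S := ℂ) π g _ hg.continuousOn
    (map_continuous π) h (h.map π)

end Columns

/-! ### Functions of `|T|` and `|T*|` -/

section Polar

open ContinuousLinearMap (adjoint)

variable {H K : Type*} [NormedAddCommGroup H] [InnerProductSpace ℂ H] [CompleteSpace H]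
  [NormedAddCommGroup K] [InnerProductSpace ℂ K] [CompleteSpace K] {T v : H →L[ℂ] K}

theorem absOp_eq_cfc (T : H →L[ℂ] K) : cfc (fun t : ℝ => t) (absOp T) = absOp T :=
  cfc_id' ℝ _ (IsSelfAdjoint.of_nonneg (absOp_nonneg T))

theorem mem_spectrum_absOp_nonneg {T : H →L[ℂ] K} {t : ℝ} (ht : t ∈ spectrum ℝ (absOp T)) :
    0 ≤ t :=
  spectrum_nonneg_of_nonneg (absOp_nonneg T) ht

/-- `v g(|T|) v* = g(|T*|)` for functions `g` of the form `t ↦ g₁(t) t`. -/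
theorem IsPolarDecomposition.comp_cfc_comp_adjoint (h : IsPolarDecomposition T v) {g : ℝ → ℝ}
    (hg : Continuous g) :
    v ∘L cfc (fun t => g t * t) (absOp T) ∘L adjoint v
      = cfc (fun t => g t * t) (absOp (adjoint T)) := by
  -- The factor `t` supplies a copy of `|T*|`, which absorbs the final projection `v v*`.
  rw [← ContinuousLinearMap.comp_assoc, h.comp_cfc (g := fun t => g t * t) (by fun_prop),
    cfc_mul g (fun t => t) (absOp (adjoint T)), absOp_eq_cfc]
  calc _ = cfc g (absOp (adjoint T)) ∘L (absOp (adjoint T) ∘L v ∘L adjoint v) := rfl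
    _ = _ := by rw [h.absOp_adjoint_comp]; rfl

theorem IsPolarDecomposition.comp_cfc_absOp (h : IsPolarDecomposition T v) {g : ℝ → ℝ}
    (hg : Continuous g) : T ∘L cfc g (absOp T) = v ∘L cfc (fun t => g t * t) (absOp T) := by
  have : cfc (fun t => g t * t) (absOp T) = absOp T * cfc g (absOp T) := by
    rw [show (fun t => g t * t) = fun t => t * g t from funext fun t => mul_comm _ _,
      cfc_mul (fun t => t) g (absOp T), absOp_eq_cfc]
  rw [this]
  exact congrArg (fun X => X ∘L cfc g (absOp T)) h.eq_comp

theorem IsPolarDecomposition.comp_cfc_comp_adjoint_self (h : IsPolarDecomposition T v)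
    {g : ℝ → ℝ} (hg : Continuous g) :
    T ∘L cfc g (absOp T) ∘L adjoint T = cfc (fun t => g t * t * t) (absOp (adjoint T)) := by
  rw [← h.comp_cfc_comp_adjoint (g := fun t => g t * t) (by fun_prop), h.adjoint_eq,
    cfc_mul (fun t => g t * t) (fun t => t) (absOp T), absOp_eq_cfc,
    ← ContinuousLinearMap.comp_assoc, h.comp_cfc_absOp hg]
  rfl

/-- For `W = T g(|T|)` with `g(t) t = 1` off `[l, u]`, the operators `W` and `v` agree after
compression by `1 - 1_{[l,u]}(|T*|)`. -/
theorem IsPolarDecomposition.one_sub_spectralProjection_comp (h : IsPolarDecomposition T v)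
    {l u : ℝ} {g : ℝ → ℝ} (hg : Continuous g)
    (h1 : ∀ t ∈ spectrum ℝ (absOp (adjoint T)), t ∉ Set.Icc l u → g t * t = 1) :
    (1 - spectralProjection (absOp (adjoint T)) (Set.Icc l u)) ∘L T ∘L cfc g (absOp T)
      = (1 - spectralProjection (absOp (adjoint T)) (Set.Icc l u)) ∘L v := by
  have hk : Continuous fun t => g t * t := by fun_prop
  have h0 := one_sub_spectralProjection_mul_cfc_eq_zero
    (IsSelfAdjoint.of_nonneg (absOp_nonneg (adjoint T))) (l := l) (u := u)
    (φ := fun t => 1 - g t * t) (by fun_prop) fun t ht ht' => by rw [h1 t ht ht', sub_self]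
  rw [cfc_sub (fun _ => 1) (fun t => g t * t) (absOp (adjoint T)), cfc_const_one ℝ _
    (IsSelfAdjoint.of_nonneg (absOp_nonneg (adjoint T))), mul_sub, mul_one, sub_eq_zero] at h0
  rw [h.comp_cfc_absOp hg, h.comp_cfc hk]
  exact (congrArg (fun X => X ∘L v) h0).symm

/-- For `W = T g(|T|)` with `g(t) t = 1` off `[l, u]`, the operator `W W*` is the identity after
compression by `1 - 1_{[l,u]}(|T*|)`. -/
theorem IsPolarDecomposition.one_sub_spectralProjection_comp_adjoint
    (h : IsPolarDecomposition T v) {l u : ℝ} {g : ℝ → ℝ} (hg : Continuous g)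
    (h1 : ∀ t ∈ spectrum ℝ (absOp (adjoint T)), t ∉ Set.Icc l u → g t * t = 1) :
    (1 - spectralProjection (absOp (adjoint T)) (Set.Icc l u)) ∘L (T ∘L cfc g (absOp T)) ∘L
      adjoint (T ∘L cfc g (absOp T))
      = 1 - spectralProjection (absOp (adjoint T)) (Set.Icc l u) := by
  have h0 := one_sub_spectralProjection_mul_cfc_eq_zero
    (IsSelfAdjoint.of_nonneg (absOp_nonneg (adjoint T))) (l := l) (u := u)
    (φ := fun t => 1 - g t * t * g t * t) (by fun_prop) fun t ht ht' => by
      rw [mul_assoc, h1 t ht ht', mul_one, sub_self]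
  rw [cfc_sub (fun _ => 1) (fun t => g t * t * g t * t) (absOp (adjoint T)), cfc_const_one ℝ _
    (IsSelfAdjoint.of_nonneg (absOp_nonneg (adjoint T))), mul_sub, mul_one, sub_eq_zero] at h0
  have hsa : adjoint (cfc g (absOp T)) = cfc g (absOp T) :=
    (cfc_predicate g (absOp T) : IsSelfAdjoint _).adjoint_eq
  have hww : (T ∘L cfc g (absOp T)) ∘L adjoint (T ∘L cfc g (absOp T))
      = cfc (fun t => g t * t * g t * t) (absOp (adjoint T)) := by
    have e : (fun t => g t * t * g t * t) = fun t => g t * g t * t * t := by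
      funext t; ring
    rw [ContinuousLinearMap.adjoint_comp, hsa, e,
      ← h.comp_cfc_comp_adjoint_self (g := fun t => g t * g t) (by fun_prop),
      cfc_mul g g (absOp T)]
    rfl
  rw [hww]
  exact h0.symm

end Polar

/-! ### The two inequalities -/

section Distance

open ContinuousLinearMap (adjoint)

variable {A : Type*} [CStarAlgebra A] [PartialOrder A] [StarOrderedRing A]
  {H : Type*} [NormedAddCommGroup H] [InnerProductSpace ℂ H] [CompleteSpace H]
  {π : A →⋆ₐ[ℂ] (H →L[ℂ] H)} {n : ℕ} {a : Column n A} {v : H →L[ℂ] HilbertPow n H}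

/-- For `(t - μ)₊ = p(t) t²`, the function `q = p / (ε + t² p)` is continuous. -/
theorem exists_cutoff_resolvent {μ ε : ℝ} (hμ : 0 < μ) (hε : 0 < ε) :
    ∃ p q : ℝ → ℝ, Continuous p ∧ Continuous q ∧ (∀ t, p t * t * t = max (t - μ) 0) ∧
      ∀ t, ε * q t + q t * t ^ 2 * p t = p t := by
  have hmax : ∀ t, 0 < max t μ := fun t => lt_max_of_lt_right hμ
  -- Dividing by `max t μ ^ 2` instead of `t ^ 2` keeps `p` continuous; the two differ only for `t <
  -- μ`, where the numerator is zero.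
  obtain ⟨p, hpdef⟩ : ∃ p : ℝ → ℝ, p = fun t => max (t - μ) 0 / max t μ ^ 2 := ⟨_, rfl⟩
  have hp : Continuous p := by
    rw [hpdef]
    exact Continuous.div₀ (by fun_prop) (by fun_prop) fun t => (pow_pos (hmax t) 2).ne'
  have hp0 : ∀ t, 0 ≤ p t := fun t => by
    rw [hpdef]; exact div_nonneg (le_max_right _ _) (sq_nonneg _)
  have hd : ∀ t, 0 < ε + t ^ 2 * p t := fun t => by have := hp0 t; positivity
  refine ⟨p, fun t => p t / (ε + t ^ 2 * p t), hp,
    hp.div₀ (by fun_prop) fun t => (hd t).ne', fun t => ?_, fun t => ?_⟩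
  · rcases le_total t μ with ht | ht
    · have h0 : max (t - μ) 0 = 0 := max_eq_right (by linarith)
      simp [hpdef, h0]
    · have h0 : t ≠ 0 := by linarith
      simp only [hpdef, max_eq_left ht]
      field_simp
  · calc _ = p t * ((ε + t ^ 2 * p t) / (ε + t ^ 2 * p t)) := by ring
      _ = p t := by rw [div_self (hd t).ne', mul_one]

/-- Since `a* a = |a|²`, the scalar identity becomes the hypothesis of `smul_add_colMul_mem_Lg` for
`p(|a|)` and `q(|a|)`. -/
theorem smul_cfc_add_cfc_mul_mul_cfc (a : Column n A) {p q : ℝ → ℝ} (hp : Continuous p)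
    (hq : Continuous q) {ε : ℝ} (h : ∀ t, ε * q t + q t * t ^ 2 * p t = p t) :
    ε • cfc q (CFC.sqrt (colInner a a))
      + cfc q (CFC.sqrt (colInner a a)) * colInner a a * cfc p (CFC.sqrt (colInner a a))
      = cfc p (CFC.sqrt (colInner a a)) := by
  have hmm := CFC.sqrt_mul_sqrt_self _ (colInner_self_nonneg a)
  have hsa : IsSelfAdjoint (CFC.sqrt (colInner a a)) := IsSelfAdjoint.of_nonneg (CFC.sqrt_nonneg _)
  generalize CFC.sqrt (colInner a a) = m at *
  rw [← hmm, ← sq, ← cfc_pow_id (R := ℝ) m 2, ← cfc_mul q (fun t => t ^ 2) m,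
    ← cfc_mul (fun t => q t * t ^ 2) p m, ← cfc_smul ε q m]
  rw [← cfc_add m (fun t => ε • q t) (fun t => q t * t ^ 2 * p t)]
  exact congrArg (fun f => cfc f m) (funext h)

theorem infDist_Lg_le (hπ : Function.Injective π) (hv : IsPolarDecomposition (columnOp π a) v)
    {lam : ℝ} (hlam : 0 ≤ lam) {s : Column n A} (hs : s ∈ Lg n A)
    (h : (1 - lowerProj π a lam) ∘L v = (1 - lowerProj π a lam) ∘L columnOp π s) :
    Metric.infDist a (Lg n A) ≤ lam := by
  refine le_of_forall_pos_le_add fun δ hδ => ?_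
  -- The error `δ` is split evenly: half opens the gap between `lam` and the support of `φ`, half
  -- pays for `ε • s`.
  set μ := lam + δ / 2 with hμ
  have hμ0 : 0 < μ := by positivity
  set ε := δ / (2 * (‖s‖ + 1)) with hεdef
  have hε : 0 < ε := by positivity
  let φ : ℝ → ℝ := fun t => max (t - μ) 0
  have hφ : Continuous φ := by fun_prop
  obtain ⟨p, q, hp, hq, hpt, hpqt⟩ := exists_cutoff_resolvent hμ0 hε
  have hpφ : (fun t => p t * t * t) = φ := funext hpt
  have hpq := smul_cfc_add_cfc_mul_mul_cfc a hp hq hpqt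
  have hmem := smul_add_colMul_mem_Lg hs a hε.ne' hpq
  refine (Metric.infDist_le_dist_of_mem hmem).trans ?_
  rw [dist_eq_norm, ← norm_columnOp π hπ, columnOp_sub, columnOp_add, columnOp_smul,
    columnOp_colMul, map_mul, map_cfc_sqrt π a hp, ← adjoint_columnOp_comp]
  have hPsa := IsSelfAdjoint.of_nonneg (absOp_nonneg (adjoint (columnOp π a)))
  have hφf : cfc φ (absOp (adjoint (columnOp π a))) * lowerProj π a lam = 0 :=
    cfc_mul_spectralProjection_eq_zero hPsa (half_pos hδ) hφ fun t ht =>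
      max_eq_right (by linarith)
  have hφr : cfc φ (absOp (adjoint (columnOp π a))) * (1 - lowerProj π a lam)
      = cfc φ (absOp (adjoint (columnOp π a))) := by rw [mul_sub, hφf, mul_one, sub_zero]
  -- The term from `s` is `φ(|a*|) s`. As `φ(|a*|)` absorbs `1 - f_λ`, the hypothesis replaces `s`
  -- by `v`.
  have e1 : columnOp π a ∘L (cfc p (absOp (columnOp π a))
      * (adjoint (columnOp π a) ∘L columnOp π s)) = v ∘L cfc φ (absOp (columnOp π a)) := by
    calc _ = (columnOp π a ∘L cfc p (absOp (columnOp π a)) ∘L adjoint (columnOp π a))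
            ∘L columnOp π s := rfl
      _ = (cfc φ (absOp (adjoint (columnOp π a))) * (1 - lowerProj π a lam))
            ∘L columnOp π s := by rw [hv.comp_cfc_comp_adjoint_self hp, hpφ, hφr]
      _ = cfc φ (absOp (adjoint (columnOp π a)))
            ∘L ((1 - lowerProj π a lam) ∘L columnOp π s) := rfl
      _ = (cfc φ (absOp (adjoint (columnOp π a))) * (1 - lowerProj π a lam)) ∘L v := by
          rw [← h]; rfl
      _ = _ := by rw [hφr, hv.comp_cfc hφ]
  have e2 : columnOp π a - v ∘L cfc φ (absOp (columnOp π a))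
      = v ∘L cfc (fun t => t - φ t) (absOp (columnOp π a)) := by
    rw [cfc_sub (fun t => t) φ (absOp (columnOp π a)), absOp_eq_cfc,
      ContinuousLinearMap.comp_sub, ← hv.eq_comp]
  -- On the spectrum `t - φ(t) = min(t, μ)`.
  have e3 : ‖cfc (fun t => t - φ t) (absOp (columnOp π a))‖ ≤ μ := by
    refine norm_cfc_le hμ0.le fun t ht => ?_
    have ht0 := mem_spectrum_absOp_nonneg ht
    rw [Real.norm_eq_abs, abs_le]
    rcases le_total t μ with h' | h'
    · have : φ t = 0 := max_eq_right (by linarith)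
      constructor <;> linarith
    · have : φ t = t - μ := max_eq_left (by linarith)
      constructor <;> linarith
  have e4 : ‖v ∘L cfc (fun t => t - φ t) (absOp (columnOp π a))‖ ≤ 1 * μ :=
    (ContinuousLinearMap.opNorm_comp_le _ _).trans
      (mul_le_mul hv.partialIsometry.norm_le_one e3 (norm_nonneg _) zero_le_one)
  have e5 : ε * ‖s‖ ≤ δ / 2 := by
    have : ε * (‖s‖ + 1) = δ / 2 := by rw [hεdef]; field_simp
    nlinarith
  rw [e1, sub_add_eq_sub_sub, sub_right_comm, e2]
  have e6 : ‖ε • columnOp π s‖ = ε * ‖s‖ := by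
    rw [← norm_columnOp π hπ]
    exact norm_smul_of_nonneg hε.le (columnOp π s)
  calc _ ≤ ‖v ∘L cfc (fun t => t - φ t) (absOp (columnOp π a))‖ + ‖ε • columnOp π s‖ :=
        norm_sub_le (v ∘L cfc (fun t => t - φ t) (absOp (columnOp π a))) (ε • columnOp π s)
    _ ≤ lam + δ := by linarith

theorem exists_mem_Lg_of_dist_lt (hπ : Function.Injective π)
    (hv : IsPolarDecomposition (columnOp π a) v) {lam : ℝ} {b : Column n A} (hb : b ∈ Lg n A)
    (hab : dist a b < lam) :
    ∃ s ∈ Lg n A,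
      (1 - lowerProj π a lam) ∘L v = (1 - lowerProj π a lam) ∘L columnOp π s := by
  have hlam : 0 < lam := dist_nonneg.trans_lt hab
  have hmax : ∀ t, 0 < max t lam := fun t => lt_max_of_lt_right hlam
  let g : ℝ → ℝ := fun t => (max t lam)⁻¹
  have hg : Continuous g := Continuous.inv₀ (by fun_prop) fun t => (hmax t).ne'
  let k : ℝ → ℝ := fun t => g t * t
  set m := CFC.sqrt (colInner a a)
  have hmsa : IsSelfAdjoint m := IsSelfAdjoint.of_nonneg (CFC.sqrt_nonneg _)
  set w := colMul a (cfc g m) with hw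
  set c := colMul b (cfc g m) with hc
  have hcL : c ∈ Lg n A := by
    -- Truncation below at `lam > 0` makes `g(|a|)` invertible in `A`, so right multiplication by it
    -- preserves `Lg`.
    refine colMul_mem_Lg hb (d := cfc (fun t => max t lam) m) ?_
    rw [← cfc_mul (fun t => max t lam) g m, ← cfc_const_one ℝ m]
    congr 1
    funext t
    exact mul_inv_cancel₀ (hmax t).ne'
  set T := columnOp π a
  have hW : columnOp π w = v ∘L cfc k (absOp T) := by
    rw [hw, columnOp_colMul, map_cfc_sqrt π a hg, hv.comp_cfc_absOp hg]
  have hk1 : ‖cfc k (absOp T)‖ ≤ 1 := by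
    refine norm_cfc_le zero_le_one fun t ht => ?_
    have ht0 := mem_spectrum_absOp_nonneg ht
    have h1 : k t = t / max t lam := by simp only [k, g]; field_simp
    rw [h1, Real.norm_of_nonneg (div_nonneg ht0 (hmax t).le)]
    exact div_le_one_of_le₀ (le_max_left _ _) (hmax t).le
  have hW1 : ‖columnOp π w‖ ≤ 1 := by
    rw [hW]
    refine (ContinuousLinearMap.opNorm_comp_le _ _).trans ?_
    exact mul_le_one₀ hv.partialIsometry.norm_le_one (norm_nonneg _) hk1
  have hZ : ‖columnOp π (c - w)‖ < 1 := by
    have e : columnOp π (c - w) = columnOp π (b - a) ∘L cfc g (absOp T) := by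
      rw [columnOp_sub, columnOp_sub, hw, hc, columnOp_colMul, columnOp_colMul,
        map_cfc_sqrt π a hg, ContinuousLinearMap.sub_comp]
    have hgn : ‖cfc g (absOp T)‖ ≤ lam⁻¹ := by
      refine norm_cfc_le (by positivity) fun t _ => ?_
      rw [Real.norm_of_nonneg (inv_nonneg.2 (hmax t).le)]
      exact inv_anti₀ hlam (le_max_right _ _)
    rw [e]
    refine (ContinuousLinearMap.opNorm_comp_le _ _).trans_lt ?_
    rw [norm_columnOp π hπ, ← dist_eq_norm, dist_comm]
    calc dist a b * ‖cfc g (absOp T)‖ ≤ dist a b * lam⁻¹ := by gcongr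
      _ < lam * lam⁻¹ := by gcongr
      _ = 1 := mul_inv_cancel₀ hlam.ne'
  -- This makes `u = 1 + w*(c - w)` invertible by the Neumann series.
  have hwz : ‖-colInner w (c - w)‖ < 1 := by
    rw [norm_neg, ← NonUnitalStarAlgHom.norm_map π hπ, ← adjoint_columnOp_comp]
    refine (ContinuousLinearMap.opNorm_comp_le _ _).trans_lt ?_
    rw [LinearIsometryEquiv.norm_map]
    exact (mul_le_of_le_one_left (norm_nonneg _) hW1).trans_lt hZ
  let u : Aˣ := Units.oneSub _ hwz
  have hu : (u : A) = 1 + colInner w (c - w) := by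
    rw [Units.val_oneSub, sub_neg_eq_add]
  refine ⟨colMul c ↑u⁻¹, colMul_mem_Lg hcL u.mul_inv, ?_⟩
  set r := 1 - lowerProj π a lam with hr
  set P := absOp (adjoint T) with hP
  -- The spectrum is nonnegative, so leaving `[0, lam]` means exceeding `lam`, where `g(t) = 1/t`.
  have hk_top : ∀ t ∈ spectrum ℝ P, t ∉ Set.Icc 0 lam → g t * t = 1 := by
    intro t ht ht'
    have ht0 := mem_spectrum_absOp_nonneg ht
    have : lam ≤ t := by
      by_contra hlt
      exact ht' ⟨ht0, (not_le.1 hlt).le⟩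
    simp only [g, max_eq_left this]
    exact inv_mul_cancel₀ (by linarith)
  have hrv : r ∘L columnOp π w = r ∘L v := by
    rw [hw, columnOp_colMul, map_cfc_sqrt π a hg]
    exact hv.one_sub_spectralProjection_comp hg hk_top
  have hrw : r ∘L columnOp π w ∘L adjoint (columnOp π w) = r := by
    rw [hw, columnOp_colMul, map_cfc_sqrt π a hg]
    exact hv.one_sub_spectralProjection_comp_adjoint hg hk_top
  have hπu : (1 + adjoint (columnOp π w) ∘L columnOp π (c - w)) ∘L π ↑u⁻¹ = 1 := by
    rw [adjoint_columnOp_comp, ← map_one π, ← map_add, ← hu]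
    change π _ * π _ = _
    rw [← map_mul, u.mul_inv]
  have hcw : columnOp π c = columnOp π w + columnOp π (c - w) := by
    rw [columnOp_sub]; abel
  -- The identity `r w w* = r` lets `r w` be factored out of the error term `r (c - w)` too.
  have e : r ∘L columnOp π c
      = (r ∘L columnOp π w) ∘L (1 + adjoint (columnOp π w) ∘L columnOp π (c - w)) := by
    have e' : (r ∘L columnOp π w) ∘L (adjoint (columnOp π w) ∘L columnOp π (c - w))
        = r ∘L columnOp π (c - w) := by
      calc _ = (r ∘L columnOp π w ∘L adjoint (columnOp π w)) ∘L columnOp π (c - w) := rfl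
        _ = _ := by rw [hrw]
    rw [hcw, ContinuousLinearMap.comp_add, ContinuousLinearMap.comp_add, e']
    rfl
  rw [columnOp_colMul, ← ContinuousLinearMap.comp_assoc, e, ContinuousLinearMap.comp_assoc, hπu,
    ← hrv]
  rfl

end Distance

end StableRank

end

open StableRank
theorem mainTheorem3 {A : Type*} [CStarAlgebra A] [PartialOrder A] [StarOrderedRing A]
    {H : Type*} [NormedAddCommGroup H] [InnerProductSpace ℂ H] [CompleteSpace H]
    (π : A →⋆ₐ[ℂ] (H →L[ℂ] H)) (hπ : Function.Injective π)
    (n : ℕ) (hn : 1 ≤ n) (a : Column n A)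
    (v : H →L[ℂ] HilbertPow n H) (hv : IsPolarDecomposition (columnOp π a) v) :
    IsGLB {lam : ℝ | 0 ≤ lam ∧ ∃ s ∈ Lg n A,
        (1 - lowerProj π a lam) ∘L v = (1 - lowerProj π a lam) ∘L columnOp π s}
      (Metric.infDist a (Lg n A)) := by
  constructor
  · rintro lam ⟨hlam, s, hs, h⟩
    exact infDist_Lg_le hπ hv hlam hs h
  · intro r hr
    refine le_of_forall_gt_imp_ge_of_dense fun lam hlam => ?_
    -- Nonemptiness of `Lg`, from `1 ≤ n`, matters: `Metric.infDist` to the empty set is `0` by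
    -- default.
    obtain ⟨b, hb, hab⟩ := (Metric.infDist_lt_iff (Lg_nonempty hn)).1 hlam
    exact hr ⟨dist_nonneg.trans hab.le, exists_mem_Lg_of_dist_lt hπ hv hb hab⟩
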